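/- **The problem.** In the open non-preemptive online dial-a-ride problem on the half-line $M=\mathbb{R}_{\ge 0}$ with capacity $c\in\mathbb{N}\cup\{\infty\}$, $c\ge 1$, a server starts at time $0$ in the origin $0$ and moves with speed at most $1$. A request $(a,b;t)$ with $a,b\in M$ and $t\ge 0$ becomes known at its release time $t$; the server has to load it at $a$ at some time not before $t$ and may unload it only at $b$. At most $c$ requests may be loaded at any time. The completion time is the time when all requests are served (the server may end anywhere). For a finite request sequence $\sigma$ let $\mathrm{Opt}(\sigma)$ be the minimum completion time of an offline solution, and let $\mathrm{Opt}(t)$ be this minimum for the subsequence of the requests released not later than time $t$. An algorithm $\mathrm{Alg}$ is $\rho$-competitive if $\mathrm{Alg}(\sigma)\le\rho\cdot\mathrm{Opt}(\sigma)$ for all finite request sequences $\sigma$; its competitive ratio is $\inf\{\rho\ge 1 : \mathrm{Alg}\text{ is }\rho\text{-competitive}\}$. **The algorithm $\textsc{Lazy}(\alpha)$.** Let $t$ be the current time. Whenever requests arrive, check whether the server can deliver all currently loaded requests and return to the origin until time $\alpha\cdot\mathrm{Opt}(t)$; if so, it aborts what it is doing, delivers the loaded requests and returns to the origin in the fastest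 possible way, and is then idle; if not, it goes on as before. Whenever the server is idle: if $t<\alpha\cdot\mathrm{Opt}(t)$, it waits at its position until time $\alpha\cdot\mathrm{Opt}(t)$ and is then idle again; otherwise, if some released requests are not served yet, it follows a shortest schedule that serves all of them from its current position, and is idle after its end; otherwise it stays where it is until the next request arrives. (Shortest schedules and fastest returns may be chosen by any tie-breaking rule.) **Theorem.** For $\alpha=\frac{1+\sqrt3}{2}$, every capacity $c\in\mathbb{N}\cup\{\infty\}$ with $c\ge1$, and every tie-breaking rule, the competitive ratio of $\textsc{Lazy}(\alpha)$ for open non-preemptive online dial-a-ride on the half-line $\mathbb{R}_{\ge 0}$ is exactly $\alpha+1=\frac{3+\sqrt3}{2}\approx 2.366$. -/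

import Mathlib

open scoped NNReal

noncomputable section

namespace DialARide

/-! ### The open non-preemptive dial-a-ride problem on the half-line -/

/-- A transportation request `(a, b; t)` on the half-line `ℝ≥0`: starting position `a`,
destination `b`, release time `t`. A request sequence is a function `σ : Fin n → Request`. -/
structure Request where
  src : ℝ≥0
  dst : ℝ≥0
  release : ℝ≥0

/-- The two kinds of actions of a (non-preemptive) server: load request `i` (at its starting
position), unload request `i` (at its destination). -/
inductive Action (n : ℕ) where
  | load (i : Fin n)
  | unload (i : Fin n)

/-- The position where an action takes place. -/
def Action.place {n : ℕ} (σ : Fin n → Request) : Action n → ℝ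
  | .load i => (σ i).src
  | .unload i => (σ i).dst

/-- The earliest time at which an action is allowed: a request can only be loaded after its
release. -/
def Action.earliest {n : ℕ} (σ : Fin n → Request) : Action n → ℝ
  | .load i => (σ i).release
  | .unload _ => 0

/-- `Serves c W D L`: a server of capacity `c` that has loaded exactly the requests in `D`
can perform the sequence of actions `L`, and thereby loads exactly the requests in `W`, each once,
and delivers all requests in `W` and `D`, never having more than `c` requests loaded when it has
just loaded one. -/
def Serves {n : ℕ} (c : ℕ∞) : Finset (Fin n) → Finset (Fin n) → List (Action n) → Prop
  | W, D, [] => W = ∅ ∧ D = ∅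
  | W, D, .load i :: L => i ∈ W ∧ ((D.card + 1 : ℕ) : ℕ∞) ≤ c ∧ Serves c (W.erase i) (insert i D) L
  | W, D, .unload i :: L => i ∈ D ∧ Serves c W (D.erase i) L

/-- `CanFinishBy σ x t L T`: a server of speed at most one, which is at position `x` at time `t`,
can perform the actions `L` in this order, respecting release times, and be done by time `T`.
(The time `s` at which each action is performed is free, so that the server may wait.) -/
def CanFinishBy {n : ℕ} (σ : Fin n → Request) : ℝ → ℝ → List (Action n) → ℝ → Prop
  | _, t, [], T => t ≤ T
  | x, t, a :: L, T =>
      ∃ s, t + |a.place σ - x| ≤ s ∧ a.earliest σ ≤ s ∧ CanFinishBy σ (a.place σ) s L T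

/-- The completion time of an optimal offline solution for the requests in `R`: the server starts
in the origin at time `0`, and may end anywhere. -/
def opt {n : ℕ} (c : ℕ∞) (σ : Fin n → Request) (R : Finset (Fin n)) : ℝ :=
  sInf {T : ℝ | ∃ L, Serves c R ∅ L ∧ CanFinishBy σ 0 0 L T}

/-- The requests released not later than time `t`. -/
def released {n : ℕ} (σ : Fin n → Request) (t : ℝ) : Finset (Fin n) :=
  Finset.univ.filter fun i => ((σ i).release : ℝ) ≤ t

/-- `Opt(t)`: the optimal completion time for the requests released not later than time `t`. -/
def optAt {n : ℕ} (c : ℕ∞) (σ : Fin n → Request) (t : ℝ) : ℝ :=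
  opt c σ (released σ t)

/-! ### Schedules followed by the algorithm -/

/-- The distance travelled by a server that starts in `x` and performs the actions `L`. -/
def travel {n : ℕ} (σ : Fin n → Request) : ℝ → List (Action n) → ℝ
  | _, [] => 0
  | x, a :: L => |a.place σ - x| + travel σ (a.place σ) L

/-- The distance travelled by a server that starts in `x`, performs the actions `L`, and finally
returns to the origin. -/
def travelHome {n : ℕ} (σ : Fin n → Request) : ℝ → List (Action n) → ℝ
  | x, [] => |x|
  | x, a :: L => |a.place σ - x| + travelHome σ (a.place σ) L

/-- `L` is a shortest schedule `S(R, x)`, serving all requests in `R` (all of them already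
released) from position `x`, starting with no request loaded. -/
def IsShortestSchedule {n : ℕ} (c : ℕ∞) (σ : Fin n → Request) (R : Finset (Fin n)) (x : ℝ)
    (L : List (Action n)) : Prop :=
  Serves c R ∅ L ∧ ∀ L', Serves c R ∅ L' → travel σ x L ≤ travel σ x L'

/-- `L` is a fastest way to deliver the loaded requests `D` from position `x` and then to return to
the origin. -/
def IsFastestReturn {n : ℕ} (c : ℕ∞) (σ : Fin n → Request) (D : Finset (Fin n)) (x : ℝ)
    (L : List (Action n)) : Prop :=
  Serves c ∅ D L ∧ ∀ L', Serves c ∅ D L' → travelHome σ x L ≤ travelHome σ x L'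

/-- Shortest schedules and fastest returns need not be unique. A `TieBreak` is a rule that chooses
one of them, at every time `t`, for every set of requests and every position. (The choice may
depend on the whole instance, so every online tie-breaking rule is included.) -/
structure TieBreak (c : ℕ∞) where
  schedule : ∀ {n : ℕ}, (Fin n → Request) → ℝ → Finset (Fin n) → ℝ → List (Action n)
  schedule_spec : ∀ {n : ℕ} (σ : Fin n → Request) (t : ℝ) (R : Finset (Fin n)) (x : ℝ),
    IsShortestSchedule c σ R x (schedule σ t R x)
  delivery : ∀ {n : ℕ}, (Fin n → Request) → ℝ → Finset (Fin n) → ℝ → List (Action n)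
  delivery_spec : ∀ {n : ℕ} (σ : Fin n → Request) (t : ℝ) (D : Finset (Fin n)) (x : ℝ),
    IsFastestReturn c σ D x (delivery σ t D x)

/-! Every finite set of requests has a shortest schedule and a fastest return, hence a rule as above
exists. -/

lemma Serves.length_eq {n : ℕ} {c : ℕ∞} (L : List (Action n)) :
    ∀ W D : Finset (Fin n), Disjoint W D → Serves c W D L → L.length = 2 * W.card + D.card := by
  induction L with
  | nil =>
    rintro W D - ⟨rfl, rfl⟩
    simp
  | cons a L ih =>
    intro W D hWD h
    cases a with
    | load i =>
      obtain ⟨hi, -, h⟩ := h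
      have hiD : i ∉ D := Finset.disjoint_left.1 hWD hi
      have hd : Disjoint (W.erase i) (insert i D) := by
        rw [Finset.disjoint_insert_right]
        exact ⟨Finset.notMem_erase i W, hWD.mono_left (Finset.erase_subset i W)⟩
      have := ih _ _ hd h
      have h1 := Finset.card_erase_add_one hi
      rw [Finset.card_insert_of_notMem hiD] at this
      simp only [List.length_cons]
      omega
    | unload i =>
      obtain ⟨hi, h⟩ := h
      have := ih _ _ (hWD.mono_right (Finset.erase_subset i D)) h
      have h1 := Finset.card_erase_add_one hi
      simp only [List.length_cons]
      omega

lemma Serves.exists_schedule {n : ℕ} {c : ℕ∞} (hc : 1 ≤ c) (R : Finset (Fin n)) :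
    ∃ L, Serves c R ∅ L := by
  induction R using Finset.induction_on with
  | empty => exact ⟨[], rfl, rfl⟩
  | insert i R hi ih =>
    obtain ⟨L, hL⟩ := ih
    exact ⟨.load i :: .unload i :: L, by simpa [Serves, hi] using ⟨hc, hL⟩⟩

lemma Serves.exists_delivery {n : ℕ} {c : ℕ∞} (D : Finset (Fin n)) :
    ∃ L, Serves c ∅ D L := by
  induction D using Finset.induction_on with
  | empty => exact ⟨[], rfl, rfl⟩
  | insert i D hi ih =>
    obtain ⟨L, hL⟩ := ih
    exact ⟨.unload i :: L, by simpa [Serves, hi] using hL⟩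

lemma Serves.finite {n : ℕ} {c : ℕ∞} {W D : Finset (Fin n)} (h : Disjoint W D) :
    {L | Serves c W D L}.Finite := by
  have : Finite (Action n) := by
    refine Finite.of_surjective (fun p : Fin n ⊕ Fin n => Sum.elim Action.load Action.unload p) ?_
    rintro (i | i)
    exacts [⟨.inl i, rfl⟩, ⟨.inr i, rfl⟩]
  exact (List.finite_length_eq (Action n) (2 * W.card + D.card)).subset
    fun L hL => Serves.length_eq L W D h hL

theorem TieBreak.nonempty {c : ℕ∞} (hc : 1 ≤ c) : Nonempty (TieBreak c) := by
  have h1 : ∀ {n : ℕ} (σ : Fin n → Request) (R : Finset (Fin n)) (x : ℝ),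
      ∃ L, IsShortestSchedule c σ R x L := fun σ R x => by
    obtain ⟨L, hL, hm⟩ := Set.exists_min_image _ (travel σ x)
      (Serves.finite (c := c) (Finset.disjoint_empty_right R)) (Serves.exists_schedule hc R)
    exact ⟨L, hL, hm⟩
  have h2 : ∀ {n : ℕ} (σ : Fin n → Request) (D : Finset (Fin n)) (x : ℝ),
      ∃ L, IsFastestReturn c σ D x L := fun σ D x => by
    obtain ⟨L, hL, hm⟩ := Set.exists_min_image _ (travelHome σ x)
      (Serves.finite (c := c) (Finset.disjoint_empty_left D)) (Serves.exists_delivery D)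
    exact ⟨L, hL, hm⟩
  exact ⟨⟨fun σ _ R x => (h1 σ R x).choose, fun σ _ R x => (h1 σ R x).choose_spec,
    fun σ _ D x => (h2 σ D x).choose, fun σ _ D x => (h2 σ D x).choose_spec⟩⟩

/-! ### The algorithm `Lazy(α)` -/

/-- What the server is currently doing. The lists contain the actions that remain to be done. -/
inductive Command (n : ℕ) where
  | idle
  | waitUntil (τ : ℝ)
  | followSchedule (L : List (Action n))
  | deliverAndReturn (L : List (Action n))

/-- The state of the server at a moment: current time, position, requests loaded, requests
already served, current command. -/
structure State (n : ℕ) where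
  time : ℝ
  pos : ℝ
  loaded : Finset (Fin n)
  served : Finset (Fin n)
  cmd : Command n

/-- At time `0` the server is idle in the origin. -/
def State.start (n : ℕ) : State n := ⟨0, 0, ∅, ∅, .idle⟩

/-- The position reached from `x` after moving towards `y` at unit speed for `δ` time units
(stopping in `y`). -/
def moveTowards (x y δ : ℝ) : ℝ :=
  if x ≤ y then min (x + δ) y else max (x - δ) y

/-- The point the server is currently heading to. -/
def waypoint {n : ℕ} (σ : Fin n → Request) (s : State n) : ℝ :=
  match s.cmd with
  | .idle => s.pos
  | .waitUntil _ => s.pos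
  | .followSchedule [] => s.pos
  | .followSchedule (a :: _) => a.place σ
  | .deliverAndReturn [] => 0
  | .deliverAndReturn (a :: _) => a.place σ

/-- The time at which the current part of the command is done, if no request arrives before. -/
def dueTime {n : ℕ} (σ : Fin n → Request) (s : State n) : Option ℝ :=
  match s.cmd with
  | .idle => none
  | .waitUntil τ => some τ
  | .followSchedule _ => some (s.time + |waypoint σ s - s.pos|)
  | .deliverAndReturn _ => some (s.time + |waypoint σ s - s.pos|)

/-- The first release time after time `t`, if there is any. -/
def nextRelease {n : ℕ} (σ : Fin n → Request) (t : ℝ) : Option ℝ :=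
  let F : Finset ℝ :=
    (Finset.univ.filter fun i => t < ((σ i).release : ℝ)).image fun i => ((σ i).release : ℝ)
  if h : F.Nonempty then some (F.min' h) else none

/-- Let time pass until time `u`, the server moving towards its current waypoint. -/
def advance {n : ℕ} (σ : Fin n → Request) (s : State n) (u : ℝ) : State n :=
  { s with time := u, pos := moveTowards s.pos (waypoint σ s) (u - s.time) }

/-- The effect of an action. -/
def perform {n : ℕ} (s : State n) : Action n → State n
  | .load i => { s with loaded := insert i s.loaded }
  | .unload i => { s with loaded := s.loaded.erase i, served := insert i s.served }

/-- The current part of the command is done: the server performs the action it was heading for,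
or becomes idle if the command is completed. -/
def finishPart {n : ℕ} (s : State n) : State n :=
  match s.cmd with
  | .idle => s
  | .waitUntil _ => { s with cmd := .idle }
  | .followSchedule [] => { s with cmd := .idle }
  | .followSchedule (a :: L) => { perform s a with cmd := .followSchedule L }
  | .deliverAndReturn [] => { s with cmd := .idle }
  | .deliverAndReturn (a :: L) => { perform s a with cmd := .deliverAndReturn L }

/-- Upon receiving a request: if the server can serve all loaded requests and return to the origin
until time `α * Opt(t)`, it aborts what it is doing and executes `deliverAndReturn`. -/
def receive {n : ℕ} {c : ℕ∞} (tb : TieBreak c) (α : ℝ) (σ : Fin n → Request) (s : State n) :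
    State n :=
  let L := tb.delivery σ s.time s.loaded s.pos
  if s.time + travelHome σ s.pos L ≤ α * optAt c σ s.time then
    { s with cmd := .deliverAndReturn L }
  else s

/-- The requests that are released but not served. -/
def pending {n : ℕ} (σ : Fin n → Request) (s : State n) : Finset (Fin n) :=
  released σ s.time \ s.served

/-- Let time pass until the next event, which is either the release of one or several requests
(all requests released at the same time are received together), or the end of the current part of
the command. -/
def elapse {n : ℕ} {c : ℕ∞} (tb : TieBreak c) (α : ℝ) (σ : Fin n → Request) (s : State n) :
    State n :=
  match nextRelease σ s.time, dueTime σ s with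
  | none, none => s
  | some r, none => receive tb α σ (advance σ s r)
  | none, some e => finishPart (advance σ s e)
  | some r, some e =>
      if r ≤ e then receive tb α σ (advance σ s r) else finishPart (advance σ s e)

/-- One step of `Lazy(α)`. An idle server waits until time `α * Opt(t)` if this time is still to
come; else it starts a shortest schedule for the pending requests, if there are any; else it stays
where it is until the next request arrives. A server that is not idle goes on with its command
until the next event. (The start needs no special treatment of the requests released at
time `0`: `deliverAndReturn` has no effect on an empty server in the origin.) -/
def step {n : ℕ} {c : ℕ∞} (tb : TieBreak c) (α : ℝ) (σ : Fin n → Request) (s : State n) :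
    State n :=
  match s.cmd with
  | .idle =>
      if s.time < α * optAt c σ s.time then
        { s with cmd := .waitUntil (α * optAt c σ s.time) }
      else if (pending σ s).Nonempty then
        { s with cmd := .followSchedule (tb.schedule σ s.time (pending σ s) s.pos) }
      else elapse tb α σ s
  | _ => elapse tb α σ s

/-- The sequence of states of the server under `Lazy(α)`. -/
def lazyRun {n : ℕ} {c : ℕ∞} (tb : TieBreak c) (α : ℝ) (σ : Fin n → Request) (k : ℕ) : State n :=
  (step tb α σ)^[k] (State.start n)

/-- `Lazy(α)` serves all requests of `σ`, and `T` is the time at which the last one is served. -/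
def LazyCompletesAt {c : ℕ∞} (tb : TieBreak c) (α : ℝ) (n : ℕ) (σ : Fin n → Request) (T : ℝ) :
    Prop :=
  ∃ k, (lazyRun tb α σ k).served = Finset.univ ∧ (lazyRun tb α σ k).time = T ∧
    ∀ j < k, (lazyRun tb α σ j).served ≠ Finset.univ

/-! ### Competitive analysis -/

/-- An algorithm, given by its completion times (`completesAt n σ T`: on `σ`, the algorithm serves
all requests, with completion time `T`), is `ρ`-competitive if it serves every request sequence
within `ρ` times the optimal completion time. -/
def IsCompetitive (c : ℕ∞) (completesAt : ∀ n : ℕ, (Fin n → Request) → ℝ → Prop) (ρ : ℝ) : Prop :=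
  ∀ (n : ℕ) (σ : Fin n → Request), ∃ T, completesAt n σ T ∧ T ≤ ρ * opt c σ Finset.univ

/-- The competitive ratio of an algorithm. -/
def competitiveRatio (c : ℕ∞) (completesAt : ∀ n : ℕ, (Fin n → Request) → ℝ → Prop) : ℝ :=
  sInf {ρ : ℝ | 1 ≤ ρ ∧ IsCompetitive c completesAt ρ}

end DialARide

end

/-!
The lower bound is attained by the single request `(1, 1; 0)`: the optimum is `1`, but the server
waits in the origin until time `α`, and needs one more time unit to get to `1`.

For the upper bound, the point is that each schedule of the algorithm, started at time `t`, ends by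
time `(1 + α) * Opt(t)`. If an offline solution loads its first request of a set `R` at `a` at time
`m`, then following it from there on shows that a shortest schedule for `R` from `x` has length at
most `|a - x| + (T - m)`, where `T` is the completion time of the solution
(`exists_first_load`). When a schedule starts in `x`, its requests are released no earlier than
time `α * x`: either `x = 0`, or `x` is the end of a previous schedule, started at some time
`t ≥ α * Opt(t) ≥ α * x` and serving all requests known then. Hence the new schedule has length at
most `Opt` (`travel_add_le_of_feasible`). This settles the schedules that start exactly at time
`α * Opt(t)`, and in particular those after a return to the origin.

A schedule can start later only if it follows immediately upon another one. Then all its requests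
are released after the start of the previous schedule, hence after `α * Opt` for the value of `Opt`
at that time, and a case distinction on the order in which an offline solution serves the requests
of both schedules gives the bound (`GoodSchedule.next`). Here `α ^ 2 = α + 1 / 2` is used: the
optimum has grown so much that `(α - 1) * Opt` is at least half the previous optimum, which bounds
the excess caused by the way back from the turning point of the previous schedule.

These facts make up an invariant of the run (`Inv`), which implies that the current time never
exceeds `(1 + α) * Opt`; a lexicographic measure (`rank`) shows that all requests are served after
finitely many steps. Returns to the origin only have to respect the deadline `α * Opt(t)`; that the
algorithm turns back whenever it can is not exploited.
-/

open scoped NNReal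

namespace DialARide

variable {n : ℕ} {c : ℕ∞} {σ : Fin n → Request}

/-! ### Action sequences -/

/-- The request an action belongs to. -/
def Action.req : Action n → Fin n
  | .load i => i
  | .unload i => i

lemma Action.place_nonneg (a : Action n) : 0 ≤ a.place σ := by
  cases a <;> exact NNReal.coe_nonneg _

/-- The actions in `L` that belong to the requests in `R`. -/
def restrict (R : Finset (Fin n)) (L : List (Action n)) : List (Action n) :=
  L.filter fun a => a.req ∈ R

/-- The position of a server that starts in `x` and performs the actions `L`. -/
noncomputable def endPos (σ : Fin n → Request) : ℝ → List (Action n) → ℝ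
  | x, [] => x
  | _, a :: L => endPos σ (a.place σ) L

/-- Forgetting all requests outside `R` turns a solution into a solution for `R`: fewer requests
are loaded at any time. -/
lemma Serves.restrict {L : List (Action n)} (R : Finset (Fin n)) :
    ∀ {W D : Finset (Fin n)}, Serves c W D L →
      Serves c (W ∩ R) (D ∩ R) (restrict R L) := by
  induction L with
  | nil =>
    rintro W D ⟨rfl, rfl⟩
    simp [DialARide.restrict, Serves]
  | cons a L ih =>
    intro W D h
    cases a with
    | load i =>
      obtain ⟨hi, hD, h⟩ := h
      have h' := ih h
      by_cases hR : i ∈ R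
      · have e1 : W.erase i ∩ R = (W ∩ R).erase i := by
          ext j; simp only [Finset.mem_inter, Finset.mem_erase]; tauto
        have e2 : insert i D ∩ R = insert i (D ∩ R) := Finset.insert_inter_of_mem hR
        rw [e1, e2] at h'
        have : DialARide.restrict R (.load i :: L) = .load i :: DialARide.restrict R L :=
          List.filter_cons_of_pos (decide_eq_true hR)
        rw [this]
        refine ⟨Finset.mem_inter.2 ⟨hi, hR⟩, le_trans ?_ hD, h'⟩
        exact_mod_cast Nat.succ_le_succ (Finset.card_le_card Finset.inter_subset_left)
      · have e1 : W.erase i ∩ R = W ∩ R := by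
          ext j; simp only [Finset.mem_inter, Finset.mem_erase]
          constructor
          · tauto
          · rintro ⟨h1, h2⟩; exact ⟨⟨fun e => hR (e ▸ h2), h1⟩, h2⟩
        have e2 : insert i D ∩ R = D ∩ R := Finset.insert_inter_of_notMem hR
        rw [e1, e2] at h'
        have : DialARide.restrict R (.load i :: L) = DialARide.restrict R L :=
          List.filter_cons_of_neg (by simp [Action.req, hR])
        rwa [this]
    | unload i =>
      obtain ⟨hi, h⟩ := h
      have h' := ih h
      by_cases hR : i ∈ R
      · have e1 : D.erase i ∩ R = (D ∩ R).erase i := by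
          ext j; simp only [Finset.mem_inter, Finset.mem_erase]; tauto
        rw [e1] at h'
        have : DialARide.restrict R (.unload i :: L) = .unload i :: DialARide.restrict R L :=
          List.filter_cons_of_pos (decide_eq_true hR)
        rw [this]
        exact ⟨Finset.mem_inter.2 ⟨hi, hR⟩, h'⟩
      · have e1 : D.erase i ∩ R = D ∩ R := by
          ext j; simp only [Finset.mem_inter, Finset.mem_erase]
          constructor
          · tauto
          · rintro ⟨h1, h2⟩; exact ⟨⟨fun e => hR (e ▸ h2), h1⟩, h2⟩
        rw [e1] at h'
        have : DialARide.restrict R (.unload i :: L) = DialARide.restrict R L :=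
          List.filter_cons_of_neg (by simp [Action.req, hR])
        rwa [this]

lemma Serves.restrict_of_subset {L : List (Action n)} {R R' : Finset (Fin n)} (hR : R ⊆ R')
    (h : Serves c R' ∅ L) : Serves c R ∅ (DialARide.restrict R L) := by
  have := h.restrict R
  rwa [Finset.inter_eq_right.2 hR, Finset.empty_inter] at this

lemma Serves.unload_mem {L : List (Action n)} :
    ∀ {W D : Finset (Fin n)}, Serves c W D L → ∀ i, i ∈ W ∨ i ∈ D → .unload i ∈ L := by
  induction L with
  | nil => rintro W D ⟨rfl, rfl⟩ i; simp
  | cons a L ih =>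
    intro W D h i hi
    cases a with
    | load j =>
      obtain ⟨-, -, h⟩ := h
      refine List.mem_cons_of_mem _ (ih h i ?_)
      simp only [Finset.mem_erase, Finset.mem_insert]
      tauto
    | unload j =>
      obtain ⟨-, h⟩ := h
      by_cases hij : i = j
      · subst hij; simp
      · refine List.mem_cons_of_mem _ (ih h i ?_)
        simp only [Finset.mem_erase]
        tauto

lemma Serves.load_mem {L : List (Action n)} :
    ∀ {W D : Finset (Fin n)}, Serves c W D L → ∀ i ∈ W, .load i ∈ L := by
  induction L with
  | nil => rintro W D ⟨rfl, rfl⟩ i; simp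
  | cons a L ih =>
    intro W D h i hi
    cases a with
    | load j =>
      obtain ⟨-, -, h⟩ := h
      by_cases hij : i = j
      · subst hij; simp
      · exact List.mem_cons_of_mem _ (ih h i (Finset.mem_erase.2 ⟨hij, hi⟩))
    | unload j => exact List.mem_cons_of_mem _ (ih h.2 i hi)

lemma Serves.mem {L : List (Action n)} {R : Finset (Fin n)} (h : Serves c R ∅ L) {a : Action n}
    (ha : a.req ∈ R) : a ∈ L := by
  cases a with
  | load i => exact h.load_mem i ha
  | unload i => exact h.unload_mem i (.inl ha)

lemma Serves.req_mem {L : List (Action n)} :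
    ∀ {W D : Finset (Fin n)}, Serves c W D L → ∀ a ∈ L, a.req ∈ W ∨ a.req ∈ D := by
  induction L with
  | nil => simp
  | cons b L ih =>
    intro W D h a ha
    cases b with
    | load j =>
      obtain ⟨hj, -, h⟩ := h
      rcases List.mem_cons.1 ha with rfl | ha
      · exact .inl hj
      · have := ih h a ha
        simp only [Finset.mem_erase, Finset.mem_insert] at this
        rcases this with h | h | h
        · exact .inl h.2
        · exact .inl (h ▸ hj)
        · exact .inr h
    | unload j =>
      obtain ⟨hj, h⟩ := h
      rcases List.mem_cons.1 ha with rfl | ha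
      · exact .inr hj
      · have := ih h a ha
        simp only [Finset.mem_erase] at this
        tauto

/-! ### Travelled distances and feasible times -/

lemma endPos_append (A B : List (Action n)) :
    ∀ x, endPos σ x (A ++ B) = endPos σ (endPos σ x A) B := by
  induction A with
  | nil => intro x; rfl
  | cons a A ih => intro x; exact ih _

lemma exists_mem_place_eq_endPos {L : List (Action n)} (hL : L ≠ []) (x : ℝ) :
    ∃ a ∈ L, endPos σ x L = a.place σ := by
  obtain ⟨A, a, rfl⟩ := (List.eq_nil_or_concat' L).resolve_left hL
  exact ⟨a, by simp, by rw [endPos_append]; rfl⟩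

lemma abs_sub_endPos_le_travel (L : List (Action n)) :
    ∀ x, |endPos σ x L - x| ≤ travel σ x L := by
  induction L with
  | nil => intro x; simp [endPos, travel]
  | cons a L ih =>
    intro x
    have h1 := ih (a.place σ)
    have h2 := abs_sub_le (endPos σ (a.place σ) L) (a.place σ) x
    simp only [endPos, travel]
    linarith

lemma travel_nonneg (L : List (Action n)) (x : ℝ) : 0 ≤ travel σ x L :=
  (abs_nonneg _).trans (abs_sub_endPos_le_travel L x)

lemma travelHome_nonneg (L : List (Action n)) : ∀ x, 0 ≤ travelHome σ x L := by
  induction L with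
  | nil => exact abs_nonneg
  | cons a L ih => exact fun x => add_nonneg (abs_nonneg _) (ih _)

/-- A server that visits the place of `a` travels at least from its start to this place and from
there to its end. -/
lemma abs_add_abs_le_travel {L : List (Action n)} {a : Action n} (ha : a ∈ L) :
    ∀ x, |a.place σ - x| + |endPos σ x L - a.place σ| ≤ travel σ x L := by
  induction L with
  | nil => simp at ha
  | cons b L ih =>
    intro x
    simp only [endPos, travel]
    rcases List.mem_cons.1 ha with rfl | ha
    · linarith [abs_sub_endPos_le_travel (σ := σ) L (a.place σ)]
    · have h1 := ih ha (b.place σ)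
      have h2 := abs_sub_le (a.place σ) (b.place σ) x
      linarith

/-- A server that reaches `x` from `y` by time `t` is no worse off than one in `x` at time `t`. -/
lemma CanFinishBy.mono_left {L : List (Action n)} {x y t t' T : ℝ} (h : CanFinishBy σ x t L T)
    (ht : t' + |x - y| ≤ t) : CanFinishBy σ y t' L T := by
  cases L with
  | nil => exact le_trans (by linarith [abs_nonneg (x - y)]) h
  | cons a L =>
    obtain ⟨s, h1, h2, h3⟩ := h
    exact ⟨s, by linarith [abs_sub_le (a.place σ) x y], h2, h3⟩

lemma CanFinishBy.sublist {L₁ L₂ : List (Action n)} (h : L₁.Sublist L₂) :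
    ∀ {x t T : ℝ}, CanFinishBy σ x t L₂ T → CanFinishBy σ x t L₁ T := by
  induction h with
  | slnil => exact id
  | cons a _ ih =>
    rintro x t T ⟨s, h1, -, h3⟩
    exact (ih h3).mono_left h1
  | cons_cons a _ ih =>
    rintro x t T ⟨s, h1, h2, h3⟩
    exact ⟨s, h1, h2, ih h3⟩

lemma CanFinishBy.append {A B : List (Action n)} :
    ∀ {x t T : ℝ}, CanFinishBy σ x t (A ++ B) T →
      ∃ u, CanFinishBy σ x t A u ∧ CanFinishBy σ (endPos σ x A) u B T := by
  induction A with
  | nil => exact fun {x t T} h => ⟨t, le_rfl, h⟩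
  | cons a A ih =>
    rintro x t T ⟨s, h1, h2, h3⟩
    obtain ⟨u, h4, h5⟩ := ih h3
    exact ⟨u, ⟨s, h1, h2, h4⟩, h5⟩

lemma CanFinishBy.add_travel_le {L : List (Action n)} :
    ∀ {x t T : ℝ}, CanFinishBy σ x t L T → t + travel σ x L ≤ T := by
  induction L with
  | nil => intro x t T h; simpa [travel, CanFinishBy] using h
  | cons a L ih =>
    rintro x t T ⟨s, h1, -, h3⟩
    have := ih h3
    simp only [travel]
    linarith

lemma CanFinishBy.exists (L : List (Action n)) :
    ∀ x t : ℝ, ∃ T, CanFinishBy σ x t L T := by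
  induction L with
  | nil => exact fun x t => ⟨t, le_rfl⟩
  | cons a L ih =>
    intro x t
    obtain ⟨T, hT⟩ := ih (a.place σ) (max (t + |a.place σ - x|) (a.earliest σ))
    exact ⟨T, _, le_max_left _ _, le_max_right _ _, hT⟩

/-! ### The offline optimum -/

/-- The requests in `R` can be served offline by time `T`, from the origin. -/
def Feasible (c : ℕ∞) (σ : Fin n → Request) (R : Finset (Fin n)) (T : ℝ) : Prop :=
  ∃ L, Serves c R ∅ L ∧ CanFinishBy σ 0 0 L T

lemma Feasible.nonneg {R : Finset (Fin n)} {T : ℝ} (h : Feasible c σ R T) : 0 ≤ T := by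
  obtain ⟨L, -, h⟩ := h
  linarith [h.add_travel_le, travel_nonneg (σ := σ) L 0]

lemma Feasible.subset {R R' : Finset (Fin n)} {T : ℝ} (h : Feasible c σ R' T) (hR : R ⊆ R') :
    Feasible c σ R T := by
  obtain ⟨L, h1, h2⟩ := h
  exact ⟨restrict R L, h1.restrict_of_subset hR, h2.sublist List.filter_sublist⟩

lemma opt_le {R : Finset (Fin n)} {T : ℝ} (h : Feasible c σ R T) : opt c σ R ≤ T :=
  csInf_le ⟨0, fun _ h => Feasible.nonneg h⟩ h

lemma le_opt (hc : 1 ≤ c) {R : Finset (Fin n)} {x : ℝ} (h : ∀ T, Feasible c σ R T → x ≤ T) :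
    x ≤ opt c σ R := by
  obtain ⟨L, hL⟩ := Serves.exists_schedule hc R
  obtain ⟨T, hT⟩ := CanFinishBy.exists (σ := σ) L 0 0
  exact le_csInf ⟨T, L, hL, hT⟩ h

lemma opt_nonneg (hc : 1 ≤ c) (R : Finset (Fin n)) : 0 ≤ opt c σ R :=
  le_opt hc fun _ h => h.nonneg

lemma opt_mono (hc : 1 ≤ c) {R R' : Finset (Fin n)} (h : R ⊆ R') : opt c σ R ≤ opt c σ R' :=
  le_opt hc fun _ hT => opt_le (hT.subset h)

lemma mem_released {t : ℝ} {i : Fin n} : i ∈ released σ t ↔ ((σ i).release : ℝ) ≤ t := by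
  simp [released]

lemma released_mono {t t' : ℝ} (h : t ≤ t') : released σ t ⊆ released σ t' := fun _ hi =>
  mem_released.2 ((mem_released.1 hi).trans h)

lemma optAt_mono (hc : 1 ≤ c) {t t' : ℝ} (h : t ≤ t') : optAt c σ t ≤ optAt c σ t' :=
  opt_mono hc (released_mono h)

lemma optAt_le_opt_univ (hc : 1 ≤ c) (t : ℝ) : optAt c σ t ≤ opt c σ Finset.univ :=
  opt_mono hc (Finset.subset_univ _)

lemma place_le_opt (hc : 1 ≤ c) {R : Finset (Fin n)} {a : Action n} (ha : a.req ∈ R) :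
    a.place σ ≤ opt c σ R := by
  refine le_opt hc fun T hT => ?_
  obtain ⟨L, h1, h2⟩ := hT
  have h3 := abs_add_abs_le_travel (σ := σ) (h1.mem ha) 0
  have h4 := h2.add_travel_le
  have h5 := abs_nonneg (endPos σ 0 L - a.place σ)
  have h6 := le_abs_self (a.place σ - 0)
  linarith

/-- In an offline solution for a set of requests containing `R`, let `i` be the first request in
`R` that is loaded, and `m` the time when this happens. The actions before and after this moment
are `A` and `B`. Since nothing of `R` has been done before, `R` can be served from `x` by moving
to the starting position of `i` and following the offline solution from there. -/
lemma exists_first_load {R R' : Finset (Fin n)} (hR : R.Nonempty) (hRR' : R ⊆ R')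
    {L : List (Action n)} {T : ℝ} (hL : Serves c R' ∅ L) (hT : CanFinishBy σ 0 0 L T) :
    ∃ (i : Fin n) (m : ℝ) (A B : List (Action n)), i ∈ R ∧ L = A ++ .load i :: B ∧
      (∀ a ∈ A, a.req ∉ R) ∧ (σ i).release ≤ m ∧
      CanFinishBy σ 0 0 (A ++ [.load i]) m ∧ CanFinishBy σ (σ i).src m B T ∧
      ∀ x S, IsShortestSchedule c σ R x S → travel σ x S ≤ |(σ i).src - x| + (T - m) := by
  have h1 := hL.restrict_of_subset hRR'
  obtain ⟨b, L₁, hb⟩ : ∃ b L₁, restrict R L = b :: L₁ := by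
    obtain ⟨j, hj⟩ := hR
    exact List.exists_cons_of_ne_nil (List.ne_nil_of_mem (h1.load_mem j hj))
  rw [hb] at h1
  cases b with
  | unload i => exact absurd h1.1 (Finset.notMem_empty i)
  | load i =>
    obtain ⟨A, B, rfl, hA, -, hB⟩ := List.filter_eq_cons_iff.1 hb
    obtain ⟨u, hu, m, hm1, hm2, hm3⟩ := hT.append
    have happ : ∀ (A : List (Action n)) (x t u : ℝ), CanFinishBy σ x t A u →
        u + |(Action.load i).place σ - endPos σ x A| ≤ m →
        CanFinishBy σ x t (A ++ [.load i]) m := by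
      intro A
      induction A with
      | nil =>
        intro x t u h1 h2
        have h1 : t ≤ u := h1
        simp only [endPos] at h2
        exact ⟨m, by linarith, hm2, le_rfl⟩
      | cons a A ih =>
        rintro x t u ⟨s, h1, h2, h3⟩ h4
        exact ⟨s, h1, h2, ih _ _ _ h3 h4⟩
    refine ⟨i, m, A, B, h1.1, rfl, fun a ha => by simpa using hA a ha, hm2,
      happ A 0 0 u hu hm1, hm3, fun x S hS => ?_⟩
    have h2 := hS.2 _ h1
    have h3 : CanFinishBy σ (σ i).src m L₁ T := hm3.sublist (hB ▸ List.filter_sublist)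
    have h4 := h3.add_travel_le
    simp only [travel, Action.place] at h2
    linarith

/-- Every offline solution takes at least as long as a shortest schedule from `x`, with a margin
proportional to `x`, if no request in `R` is released before time `α * x`. Indeed, let the offline
solution load its first request at `a` at time `m`; following it from there on is a schedule of
length at most `|a - x| + (F - m)`. If `x ≤ a`, then `m ≥ a`, as the solution starts in the origin,
and if `a < x`, then `m ≥ α * x`. -/
lemma travel_add_le_of_feasible {α x : ℝ} (hα : α ≤ 2) (hx : 0 ≤ x)
    {R : Finset (Fin n)} (hR : R.Nonempty) (hrel : ∀ i ∈ R, α * x ≤ (σ i).release)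
    {S : List (Action n)} (hS : IsShortestSchedule c σ R x S) {F : ℝ} (hF : Feasible c σ R F) :
    travel σ x S + (α - 1) * x ≤ F := by
  obtain ⟨L, hL, hT⟩ := hF
  obtain ⟨i, m, A, B, hi, -, -, hm, hA, -, h⟩ := exists_first_load hR subset_rfl hL hT
  have h1 := h x S hS
  have h2 := hrel i hi
  have h3 := hA.add_travel_le
  have h4 := abs_sub_endPos_le_travel (σ := σ) (A ++ [.load i]) 0
  rw [endPos_append] at h4
  simp only [endPos, Action.place] at h4
  have h5 : (0 : ℝ) ≤ (σ i).src := NNReal.coe_nonneg _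
  have h6 := le_abs_self ((σ i).src - 0 : ℝ)
  rcases le_total x (σ i).src with h7 | h7
  · rw [abs_of_nonneg (by linarith)] at h1
    nlinarith
  · rw [abs_of_nonpos (by linarith)] at h1
    nlinarith

/-- `Opt(t) ≥ t` if a request is released at time `t`. -/
lemma le_optAt_of_release (hc : 1 ≤ c) (i : Fin n) :
    ((σ i).release : ℝ) ≤ optAt c σ (σ i).release := by
  refine le_opt hc fun T hT => ?_
  obtain ⟨L, hL, hT⟩ := hT
  obtain ⟨j, m, A, B, hj, -, -, hm, hA, hB, -⟩ := exists_first_load (Finset.singleton_nonempty i)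
    (Finset.singleton_subset_iff.2 (mem_released.2 le_rfl)) hL hT
  rw [Finset.mem_singleton.1 hj] at hm
  linarith [hB.add_travel_le, travel_nonneg (σ := σ) B (σ j).src]

/-! ### Consecutive schedules -/

/-- `S` is a schedule for the requests `R` that starts in `x` at time `t ≥ α * Opt(t)`, ends by time
`(1 + α) * Opt(t)`, and takes no more time than any offline solution for `R`, even if `(α - 1) * x` is
added to its length. -/
structure GoodSchedule (c : ℕ∞) (σ : Fin n → Request) (α t x : ℝ) (R : Finset (Fin n))
    (S : List (Action n)) : Prop where
  pos_nonneg : 0 ≤ x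
  nonempty : R.Nonempty
  subset : R ⊆ released σ t
  serves : Serves c R ∅ S
  alpha_mul_opt_le : α * optAt c σ t ≤ t
  travel_add_le : ∀ F, Feasible c σ R F → travel σ x S + (α - 1) * x ≤ F
  end_le : t + travel σ x S ≤ (1 + α) * optAt c σ t

lemma GoodSchedule.ne_nil {α t x : ℝ} {R : Finset (Fin n)} {S : List (Action n)}
    (h : GoodSchedule c σ α t x R S) : S ≠ [] := by
  obtain ⟨j, hj⟩ := h.nonempty
  exact List.ne_nil_of_mem (h.serves.load_mem j hj)

lemma GoodSchedule.exists_last {α t x : ℝ} {R : Finset (Fin n)} {S : List (Action n)}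
    (h : GoodSchedule c σ α t x R S) : ∃ a : Action n, a.req ∈ R ∧ endPos σ x S = a.place σ := by
  obtain ⟨a, ha, h1⟩ := exists_mem_place_eq_endPos (σ := σ) h.ne_nil x
  exact ⟨a, (h.serves.req_mem a ha).resolve_right (Finset.notMem_empty _), h1⟩

/-- If a shortest schedule `S'` is started immediately after a good schedule `S`, and serves only
requests released after the start of `S`, then it ends within the competitive bound as well.

Let `p` be the end of `S`, and let an offline solution load the first request served by `S'` at `a`
at time `m`, so that `S'` has length at most `|a - p| + (T - m)`. As `m > t ≥ α * Opt(t)`, there is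
slack unless the detour to `a` is long. If `a < p`, the offline solution visits `p` as well, before
or after `a`, and pays for the detour. If `p ≤ a`, either it serves all requests of `S` before
going to `a`, which takes at least the length of `S`, or it comes back from `a` to a place
visited by `S`. -/
lemma GoodSchedule.next (hc : 1 ≤ c) {α t x : ℝ} (hα : α ^ 2 = α + 1 / 2) (hα1 : 4 / 3 ≤ α)
    {R : Finset (Fin n)} {S : List (Action n)} (h : GoodSchedule c σ α t x R S)
    {R' V : Finset (Fin n)} {S' : List (Action n)} (hne : R'.Nonempty)
    (hR' : ∀ i ∈ R', t < (σ i).release) (hV : R' ⊆ V) (htV : released σ t ⊆ V)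
    (hS' : IsShortestSchedule c σ R' (endPos σ x S) S') :
    t + travel σ x S + travel σ (endPos σ x S) S' ≤ (1 + α) * opt c σ V := by
  have hαp : 0 < 1 + α := by linarith
  rw [← div_le_iff₀' hαp]
  refine le_opt hc fun T hfeas => (div_le_iff₀' hαp).2 ?_
  have hOT : optAt c σ t ≤ T := opt_le (hfeas.subset htV)
  obtain ⟨L, hL, hT⟩ := hfeas
  obtain ⟨i, m, A, B, hi, rfl, hA, hm, hAm, hBT, hN⟩ := exists_first_load hne hV hL hT
  have hN := hN _ _ hS'
  have htm := (hR' i hi).trans_le hm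
  have hiR : i ∉ R := fun hiR =>
    absurd (mem_released.1 (h.subset hiR)) (not_le.2 (hR' i hi))
  have hOℓ : travel σ x S + (α - 1) * x ≤ optAt c σ t :=
    le_opt hc fun F hF => h.travel_add_le F (hF.subset h.subset)
  have hO := h.alpha_mul_opt_le
  have hend := h.end_le
  have hx := h.pos_nonneg
  obtain ⟨z, hz, hpz⟩ := h.exists_last
  have hpO : endPos σ x S ≤ optAt c σ t := hpz ▸ place_le_opt hc (h.subset hz)
  have hp0 : 0 ≤ endPos σ x S := hpz ▸ z.place_nonneg
  -- The offline solution travels from the origin to `b` and then to the first load of `R'`.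
  have hbefore : ∀ b ∈ A, b.place σ + |(σ i).src - b.place σ| ≤ m := fun b hb => by
    have h1 := abs_add_abs_le_travel (σ := σ) (List.mem_append_left [.load i] hb) 0
    rw [endPos_append] at h1
    change _ + |((σ i).src : ℝ) - b.place σ| ≤ _ at h1
    linarith [hAm.add_travel_le, le_abs_self (b.place σ - 0)]
  -- From the first load of `R'`, it has to travel to the places visited later.
  have hafter : ∀ b ∈ B, m + |b.place σ - (σ i).src| ≤ T := fun b hb => by
    have h1 := abs_add_abs_le_travel (σ := σ) hb (σ i).src
    linarith [hBT.add_travel_le, abs_nonneg (endPos σ (σ i).src B - b.place σ)]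
  have hmT : m ≤ T := by linarith [hBT.add_travel_le, travel_nonneg (σ := σ) B (σ i).src]
  have ham : (σ i).src ≤ m := by
    have h4 := abs_sub_endPos_le_travel (σ := σ) (A ++ [.load i]) 0
    rw [endPos_append] at h4
    simp only [endPos, Action.place] at h4
    linarith [hAm.add_travel_le, le_abs_self ((σ i).src - 0 : ℝ)]
  -- The schedule `S` runs from `x` via the place of `b` to its end.
  have hturn : ∀ b : Action n, b.req ∈ R →
      2 * b.place σ ≤ travel σ x S + endPos σ x S + x := fun b hb => by
    have h1 := abs_add_abs_le_travel (σ := σ) (h.serves.mem hb) x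
    linarith [le_abs_self (b.place σ - x), neg_abs_le (endPos σ x S - b.place σ)]
  have hRV : R ⊆ V := h.subset.trans htV
  have hcases : ∀ b : Action n, b.req ∈ R → b ∈ A ∨ b ∈ B := fun b hb => by
    have h1 := hL.mem (hRV hb)
    rcases List.mem_append.1 h1 with h1 | h1
    · exact .inl h1
    · rcases List.mem_cons.1 h1 with rfl | h1
      · exact absurd hb hiR
      · exact .inr h1
  have ha0 : (0 : ℝ) ≤ (σ i).src := NNReal.coe_nonneg _
  have hααO : α * (α * optAt c σ t) = α * optAt c σ t + optAt c σ t / 2 := by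
    linear_combination optAt c σ t * hα
  have hαm : α * (α * optAt c σ t) ≤ α * m :=
    mul_le_mul_of_nonneg_left (hO.trans htm.le) (by linarith)
  have hαT : α * m ≤ α * T := mul_le_mul_of_nonneg_left hmT (by linarith)
  have hO0 : 0 ≤ optAt c σ t := opt_nonneg hc _
  have hαO : 4 / 3 * optAt c σ t ≤ α * optAt c σ t := mul_le_mul_of_nonneg_right hα1 hO0
  have hαx : 4 / 3 * x ≤ α * x := mul_le_mul_of_nonneg_right hα1 hx
  have hLB := h.travel_add_le
  have hRne := h.nonempty
  clear h
  generalize endPos σ x S = p at *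
  generalize optAt c σ t = O at *
  generalize travel σ x S = ℓ at *
  generalize travel σ p S' = N at *
  generalize hai : ((σ i).src : ℝ) = a at *
  rcases lt_or_ge a p with hap | hap
  · -- The offline solution also visits the end of `S`, as its last action belongs to `R`.
    rw [abs_of_neg (by linarith)] at hN
    rcases hcases z hz with hzA | hzB
    · have h1 := hbefore z hzA
      rw [← hpz, abs_of_neg (by linarith)] at h1
      rcases le_total (O / 2) p with h2 | h2 <;> nlinarith
    · have h1 := hafter z hzB
      rw [← hpz, abs_of_pos (by linarith)] at h1
      have h2 : α * (m + (p - a)) ≤ α * T := mul_le_mul_of_nonneg_left (by linarith) (by linarith)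
      nlinarith
  · rw [abs_of_nonneg (by linarith)] at hN
    by_cases hall : ∀ b ∈ B, b.req ∉ R
    · -- `R` is served completely before `R'`, which takes as long as a solution for `R` alone,
      -- and this solution ends in a place that `S` visits.
      have hrestr : restrict R (A ++ .load i :: B) = restrict R A := by
        have h1 : restrict R (.load i :: B) = [] :=
          List.filter_eq_nil_iff.2 fun b hb => by
            rcases List.mem_cons.1 hb with rfl | hb
            · simp [Action.req, hiR]
            · simpa using hall b hb
        rw [restrict, List.filter_append]
        change restrict R A ++ restrict R (.load i :: B) = _
        rw [h1, List.append_nil]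
      have hserve := hL.restrict_of_subset hRV
      rw [hrestr] at hserve
      have h1 : CanFinishBy σ 0 0 (restrict R A ++ [.load i]) m :=
        hAm.sublist (List.filter_sublist.append_right _)
      obtain ⟨u, hu, s, hs1, -, hs2⟩ := h1.append
      have hs2 : s ≤ m := hs2
      have hF := hLB u ⟨_, hserve, hu⟩
      obtain ⟨j, hj⟩ := hRne
      obtain ⟨b, hb, hbe⟩ := exists_mem_place_eq_endPos (σ := σ)
        (List.ne_nil_of_mem (hserve.load_mem j hj)) 0
      have h2 := hturn b ((hserve.req_mem b hb).resolve_right (Finset.notMem_empty _))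
      rw [hbe] at hs1
      have hs1 : u + |a - b.place σ| ≤ s := hai ▸ hs1
      have h3 := le_abs_self (a - b.place σ)
      nlinarith
    · -- Some place of `R` is visited after the first load of `R'`.
      push Not at hall
      obtain ⟨b, hb, hbR⟩ := hall
      have h1 := hafter b hb
      have h2 := hturn b hbR
      generalize b.place σ = w at *
      rcases le_total w a with h3 | h3
      · rw [abs_of_nonpos (by linarith)] at h1
        nlinarith
      · nlinarith

/-! ### Events -/

lemma moveTowards_self (x : ℝ) {δ : ℝ} (hδ : 0 ≤ δ) : moveTowards x x δ = x := by
  simp [moveTowards, hδ]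

lemma moveTowards_nonneg {x y : ℝ} (hx : 0 ≤ x) (hy : 0 ≤ y) {δ : ℝ} (hδ : 0 ≤ δ) :
    0 ≤ moveTowards x y δ := by
  unfold moveTowards
  split_ifs
  · exact le_min (by linarith) hy
  · exact le_max_of_le_right hy

lemma abs_sub_moveTowards {x y δ : ℝ} (hδ : δ ≤ |y - x|) :
    |y - moveTowards x y δ| = |y - x| - δ := by
  unfold moveTowards
  split_ifs with h
  · rw [abs_of_nonneg (sub_nonneg.2 h)] at hδ ⊢
    rw [min_eq_left (by linarith), abs_of_nonneg (by linarith)]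
    ring
  · push Not at h
    rw [abs_of_neg (sub_neg.2 h)] at hδ ⊢
    rw [max_eq_left (by linarith), abs_of_nonpos (by linarith)]
    ring

lemma waypoint_nonneg {s : State n} (h : 0 ≤ s.pos) : 0 ≤ waypoint σ s := by
  unfold waypoint
  split
  all_goals first | exact h | exact le_rfl | exact Action.place_nonneg _

lemma released_eq_of_nextRelease_eq_none {t : ℝ} (h : nextRelease σ t = none) :
    released σ t = Finset.univ := by
  unfold nextRelease at h
  simp only [Finset.image_nonempty, dite_eq_right_iff, reduceCtorEq, imp_false,
    Finset.not_nonempty_iff_eq_empty, Finset.filter_eq_empty_iff, Finset.mem_univ, not_lt,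
    true_imp_iff] at h
  ext i
  simp [mem_released, @h i]

lemma nextRelease_eq_some {t r : ℝ} (h : nextRelease σ t = some r) :
    t < r ∧ (∃ i, ((σ i).release : ℝ) = r) ∧ ∀ u, t ≤ u → u < r → released σ u = released σ t := by
  unfold nextRelease at h
  simp only at h
  split_ifs at h with hne
  obtain rfl := Option.some.inj h
  have h1 := Finset.min'_mem _ hne
  obtain ⟨i, hi, hir⟩ := Finset.mem_image.1 h1
  refine ⟨hir ▸ (Finset.mem_filter.1 hi).2, ⟨i, hir⟩, fun u htu hur => ?_⟩
  refine Finset.Subset.antisymm (fun j hj => ?_) (released_mono htu)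
  rw [mem_released] at hj ⊢
  by_contra! hlt
  have hmem : ((σ j).release : ℝ) ∈ (Finset.univ.filter fun i => t < ((σ i).release : ℝ)).image
      fun i => ((σ i).release : ℝ) :=
    Finset.mem_image.2 ⟨j, Finset.mem_filter.2 ⟨Finset.mem_univ j, hlt⟩, rfl⟩
  exact absurd (Finset.min'_le _ _ hmem) (not_le.2 (hj.trans_lt hur))

/-- The three possible outcomes of waiting for the next event: a release, the end of the current
part of the command, or nothing at all. -/
lemma elapse_cases (tb : TieBreak c) (α : ℝ) (s : State n)
    (hdue : ∀ e, dueTime σ s = some e → s.time ≤ e) :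
    (∃ i, s.time < (σ i).release ∧ (∀ e, dueTime σ s = some e → (σ i).release ≤ e) ∧
      elapse tb α σ s = receive tb α σ (advance σ s (σ i).release)) ∨
    (∃ e, dueTime σ s = some e ∧ released σ e = released σ s.time ∧
      elapse tb α σ s = finishPart (advance σ s e)) ∨
    (dueTime σ s = none ∧ released σ s.time = Finset.univ ∧ elapse tb α σ s = s) := by
  unfold elapse
  rcases hr : nextRelease σ s.time with _ | r <;> rcases he : dueTime σ s with _ | e
  · exact .inr (.inr ⟨rfl, released_eq_of_nextRelease_eq_none hr, rfl⟩)
  · refine .inr (.inl ⟨e, rfl, ?_, rfl⟩)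
    have h1 := released_eq_of_nextRelease_eq_none hr
    rw [h1]
    exact Finset.univ_subset_iff.1 (h1 ▸ released_mono (hdue e he))
  · obtain ⟨h1, ⟨i, rfl⟩, -⟩ := nextRelease_eq_some hr
    exact .inl ⟨i, h1, by simp, rfl⟩
  · obtain ⟨h1, ⟨i, rfl⟩, h2⟩ := nextRelease_eq_some hr
    by_cases h3 : ((σ i).release : ℝ) ≤ e
    · refine .inl ⟨i, h1, fun e' he' => Option.some.inj he' ▸ h3, ?_⟩
      simp [h3]
    · refine .inr (.inl ⟨e, rfl, h2 e (hdue e he) (not_le.1 h3), ?_⟩)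
      simp [h3]

/-! ### The invariant of a run -/

/-- The situation of an idle server that has just completed a good schedule. -/
def JustFinished (c : ℕ∞) (σ : Fin n → Request) (α : ℝ) (s : State n) : Prop :=
  ∃ t x R S, GoodSchedule c σ α t x R S ∧ s.time = t + travel σ x S ∧ s.pos = endPos σ x S ∧
    released σ t ⊆ s.served

/-- The part of the invariant that depends on the current command. While the server is idle or
waits, no unserved request, be it known or not, is released before time `α * pos`: a server away
from the origin has come there by a schedule that was started no earlier than `α * pos` and served
all requests known at its start. While a schedule is followed, `t`, `x`, `R`, `S` are its start time, its start
position, its requests and its actions, and `W` are the requests in `R` that are not loaded yet. -/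
def CmdInv (c : ℕ∞) (σ : Fin n → Request) (α : ℝ) (s : State n) : Command n → Prop
  | .idle => s.loaded = ∅ ∧ (∀ i ∉ s.served, α * s.pos ≤ (σ i).release) ∧
      (s.time ≤ α * optAt c σ s.time ∨ JustFinished c σ α s)
  | .waitUntil τ => s.loaded = ∅ ∧ (∀ i ∉ s.served, α * s.pos ≤ (σ i).release) ∧
      s.time ≤ τ ∧ τ ≤ α * optAt c σ s.time
  | .followSchedule L => ∃ t x R S W, GoodSchedule c σ α t x R S ∧ t ≤ s.time ∧
      s.time + travel σ s.pos L = t + travel σ x S ∧ endPos σ s.pos L = endPos σ x S ∧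
      Serves c W s.loaded L ∧ ∀ i ∈ released σ t, i ∈ s.served ∨ i ∈ s.loaded ∨ i ∈ W
  | .deliverAndReturn L => Serves c ∅ s.loaded L ∧
      s.time + travelHome σ s.pos L ≤ α * optAt c σ s.time

/-- The invariant of a run of `Lazy(α)`. -/
def Inv (c : ℕ∞) (σ : Fin n → Request) (α : ℝ) (s : State n) : Prop :=
  0 ≤ s.pos ∧ CmdInv c σ α s s.cmd

lemma Inv.start (hc : 1 ≤ c) {α : ℝ} (hα : 0 ≤ α) : Inv c σ α (State.start n) :=
  ⟨le_rfl, rfl, fun i _ => by simp [State.start], .inl (mul_nonneg hα (opt_nonneg hc _))⟩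

/-- At any time of the run, the current time is within the competitive bound. -/
lemma Inv.time_le (hc : 1 ≤ c) {α : ℝ} (hα : 0 ≤ α) {s : State n} (h : Inv c σ α s) :
    s.time ≤ (1 + α) * opt c σ Finset.univ := by
  obtain ⟨-, h⟩ := h
  have h1 := optAt_le_opt_univ (σ := σ) hc s.time
  have h2 : α * optAt c σ s.time ≤ α * opt c σ Finset.univ := mul_le_mul_of_nonneg_left h1 hα
  have h3 : 0 ≤ opt c σ Finset.univ := opt_nonneg hc _
  have h4 : ∀ t, (1 + α) * optAt c σ t ≤ (1 + α) * opt c σ Finset.univ := fun t =>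
    mul_le_mul_of_nonneg_left (optAt_le_opt_univ hc t) (by linarith)
  rcases hcmd : s.cmd with _ | τ | L | L <;> rw [hcmd] at h
  · obtain ⟨-, -, h | ⟨t, x, R, S, h, ht, -⟩⟩ := h
    · linarith
    · linarith [h.end_le, h4 t]
  · obtain ⟨-, -, h5, h6⟩ := h
    linarith
  · obtain ⟨t, x, R, S, W, h, -, h5, -⟩ := h
    linarith [h.end_le, h4 t, travel_nonneg (σ := σ) L s.pos]
  · obtain ⟨-, h⟩ := h
    linarith [travelHome_nonneg (σ := σ) L s.pos]

lemma Inv.time_le_dueTime {α : ℝ} {s : State n} (h : Inv c σ α s) :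
    ∀ e, dueTime σ s = some e → s.time ≤ e := by
  obtain ⟨-, h⟩ := h
  intro e he
  rcases hcmd : s.cmd with _ | τ | L | L <;> simp only [dueTime, hcmd] at he <;> rw [hcmd] at h
  · simp at he
  · exact Option.some.inj he ▸ h.2.2.1
  all_goals
    rw [← Option.some.inj he]
    linarith [abs_nonneg (waypoint σ s - s.pos)]

/-- Before the due time of the command, the invariant is preserved under the passage of time. An
idle server waits for a release, which catches up with the deadline. -/
lemma Inv.advance (hc : 1 ≤ c) {α : ℝ} (hα : 1 ≤ α) {s : State n} (h : Inv c σ α s) {u : ℝ}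
    (hu : s.time ≤ u) (hdue : ∀ e, dueTime σ s = some e → u ≤ e)
    (hidle : s.cmd = .idle → u ≤ optAt c σ u) : Inv c σ α (advance σ s u) := by
  obtain ⟨hpos, h⟩ := h
  have hδ : 0 ≤ u - s.time := by linarith
  refine ⟨moveTowards_nonneg hpos (waypoint_nonneg hpos) hδ, ?_⟩
  have hopt : α * optAt c σ s.time ≤ α * optAt c σ u :=
    mul_le_mul_of_nonneg_left (optAt_mono hc hu) (by linarith)
  change CmdInv c σ α _ s.cmd
  rcases hcmd : s.cmd with _ | τ | L | L <;> rw [hcmd] at h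
  · have hp : (DialARide.advance σ s u).pos = s.pos := by
      simp only [DialARide.advance, waypoint, hcmd]; exact moveTowards_self _ hδ
    obtain ⟨h1, h2, -⟩ := h
    refine ⟨h1, fun i hi => hp ▸ h2 i hi, .inl ?_⟩
    have h3 := hidle hcmd
    have h4 : 0 ≤ optAt c σ u := opt_nonneg hc _
    change u ≤ α * optAt c σ u
    nlinarith
  · have hp : (DialARide.advance σ s u).pos = s.pos := by
      simp only [DialARide.advance, waypoint, hcmd]; exact moveTowards_self _ hδ
    obtain ⟨h1, h2, h3, h4⟩ := h
    exact ⟨h1, fun i hi => hp ▸ h2 i hi, hdue τ (by simp [dueTime, hcmd]), h4.trans hopt⟩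
  · have h0 := hdue _ (by simp only [dueTime, hcmd]; rfl)
    obtain ⟨t, x, R, S, W, h1, h2, h3, h4, h5, h6⟩ := h
    refine ⟨t, x, R, S, W, h1, h2.trans hu, ?_, ?_, h5, h6⟩
    · rw [← h3]
      cases L with
      | nil =>
        simp only [waypoint, hcmd, sub_self, abs_zero] at h0
        simp only [travel]
        change u + 0 = _
        linarith
      | cons a L =>
        simp only [waypoint, hcmd] at h0
        have := abs_sub_moveTowards (x := s.pos) (y := a.place σ) (δ := u - s.time) (by linarith)
        simp only [travel, DialARide.advance, waypoint, hcmd]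
        linarith
    · rw [← h4]
      cases L with
      | nil =>
        simp only [DialARide.advance, waypoint, hcmd, endPos]
        exact moveTowards_self _ hδ
      | cons a L => rfl
  · have h0 := hdue _ (by simp only [dueTime, hcmd]; rfl)
    obtain ⟨h1, h2⟩ := h
    refine ⟨h1, le_trans ?_ (h2.trans hopt)⟩
    cases L with
    | nil =>
      simp only [waypoint, hcmd] at h0
      have := abs_sub_moveTowards (x := s.pos) (y := 0) (δ := u - s.time) (by linarith)
      rw [zero_sub, zero_sub, abs_neg, abs_neg] at this
      simp only [travelHome, DialARide.advance, waypoint, hcmd]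
      linarith
    | cons a L =>
      simp only [waypoint, hcmd] at h0
      have := abs_sub_moveTowards (x := s.pos) (y := a.place σ) (δ := u - s.time) (by linarith)
      simp only [travelHome, DialARide.advance, waypoint, hcmd]
      linarith

/-- The condition for turning back is the invariant of `deliverAndReturn`; nothing has to be known
about a server that goes on. -/
lemma Inv.receive (tb : TieBreak c) {α : ℝ} {s : State n} (h : Inv c σ α s) :
    Inv c σ α (receive tb α σ s) := by
  unfold DialARide.receive
  simp only
  split_ifs with h1
  · exact ⟨h.1, (tb.delivery_spec σ s.time s.loaded s.pos).1, h1⟩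
  · exact h

/-- At its due time, the server has reached its waypoint. -/
lemma advance_dueTime_pos {s : State n} {e : ℝ} (he : dueTime σ s = some e)
    (hte : s.time ≤ e) : (advance σ s e).pos = waypoint σ s := by
  have h0 : 0 ≤ e - s.time := by linarith
  have key : e = s.time + |waypoint σ s - s.pos| → (advance σ s e).pos = waypoint σ s := by
    intro h
    have := abs_sub_moveTowards (x := s.pos) (y := waypoint σ s) (δ := e - s.time) (by linarith)
    change moveTowards _ _ _ = _
    have h2 : |waypoint σ s - moveTowards s.pos (waypoint σ s) (e - s.time)| = 0 := by linarith
    linarith [abs_eq_zero.1 h2]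
  rcases hcmd : s.cmd with _ | τ | L | L <;> simp only [dueTime, hcmd] at he
  · simp at he
  · simp only [advance, waypoint, hcmd]
    exact moveTowards_self _ h0
  all_goals exact key (Option.some.inj he).symm

lemma Inv.finishPart (hc : 1 ≤ c) {α : ℝ} (hα : 0 ≤ α) {s : State n} (h : Inv c σ α s)
    (hw : s.pos = waypoint σ s) : Inv c σ α (finishPart s) := by
  obtain ⟨hpos, h⟩ := h
  rcases hcmd : s.cmd with _ | τ | L | L
  · simp only [DialARide.finishPart, hcmd]
    exact ⟨hpos, h⟩
  · simp only [DialARide.finishPart, hcmd]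
    rw [hcmd] at h
    obtain ⟨h1, h2, h3, h4⟩ := h
    exact ⟨hpos, h1, h2, .inl (h3.trans h4)⟩
  · rw [hcmd] at h
    obtain ⟨t, x, R, S, W, h1, h2, h3, h4, h5, h6⟩ := h
    cases L with
    | nil =>
      simp only [DialARide.finishPart, hcmd]
      obtain ⟨rfl, h5⟩ := h5
      have h7 : released σ t ⊆ s.served := fun i hi => by simpa [h5] using h6 i hi
      have h3 : s.time + 0 = _ := h3
      refine ⟨hpos, h5, fun i hi => ?_, .inr ⟨t, x, R, S, h1, by simpa using h3, h4, h7⟩⟩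
      obtain ⟨z, hz, hpz⟩ := h1.exists_last
      have h8 : s.pos ≤ optAt c σ t := by
        have h4 : s.pos = _ := h4
        rw [h4, hpz]
        exact place_le_opt hc (h1.subset hz)
      have h9 : ¬ ((σ i).release : ℝ) ≤ t := fun hit => hi (h7 (mem_released.2 hit))
      have h10 := h1.alpha_mul_opt_le
      have h11 : α * s.pos ≤ α * optAt c σ t := mul_le_mul_of_nonneg_left h8 hα
      change α * s.pos ≤ _
      linarith
    | cons a L =>
      have hw : s.pos = a.place σ := by simpa only [waypoint, hcmd] using hw
      replace h3 : s.time + (|a.place σ - s.pos| + travel σ (a.place σ) L) = _ := h3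
      rw [← hw, sub_self, abs_zero, zero_add] at h3
      replace h4 : endPos σ (a.place σ) L = _ := h4
      rw [← hw] at h4
      simp only [DialARide.finishPart, hcmd]
      cases a with
      | load i =>
        obtain ⟨hi, -, h5⟩ := h5
        refine ⟨hpos, t, x, R, S, W.erase i, h1, h2, h3, h4, h5, fun j hj => ?_⟩
        have := h6 j hj
        simp only [perform, Finset.mem_insert, Finset.mem_erase]
        tauto
      | unload i =>
        obtain ⟨hi, h5⟩ := h5
        refine ⟨hpos, t, x, R, S, W, h1, h2, h3, h4, h5, fun j hj => ?_⟩
        have := h6 j hj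
        simp only [perform, Finset.mem_insert, Finset.mem_erase]
        tauto
  · rw [hcmd] at h
    obtain ⟨h1, h2⟩ := h
    cases L with
    | nil =>
      have hw : s.pos = 0 := by simpa only [waypoint, hcmd] using hw
      simp only [DialARide.finishPart, hcmd]
      refine ⟨hpos, h1.2, fun i _ => ?_, .inl ?_⟩
      · change α * s.pos ≤ _
        rw [hw, mul_zero]
        exact NNReal.coe_nonneg _
      · exact le_trans (by linarith [travelHome_nonneg (σ := σ) [] s.pos]) h2
    | cons a L =>
      have hw : s.pos = a.place σ := by simpa only [waypoint, hcmd] using hw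
      replace h2 : s.time + (|a.place σ - s.pos| + travelHome σ (a.place σ) L) ≤ _ := h2
      rw [← hw, sub_self, abs_zero, zero_add] at h2
      simp only [DialARide.finishPart, hcmd]
      cases a with
      | load i => exact absurd h1.1 (Finset.notMem_empty i)
      | unload i => exact ⟨hpos, h1.2, h2⟩

lemma Inv.elapse (hc : 1 ≤ c) (tb : TieBreak c) {α : ℝ} (hα : 1 ≤ α) {s : State n}
    (h : Inv c σ α s) : Inv c σ α (elapse tb α σ s) := by
  rcases elapse_cases tb α s h.time_le_dueTime with ⟨i, h1, h2, h3⟩ | ⟨e, h1, -, h3⟩ | ⟨-, -, h3⟩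
  · rw [h3]
    exact (h.advance hc hα h1.le h2 fun _ => le_optAt_of_release hc i).receive tb
  · rw [h3]
    have hte := h.time_le_dueTime e h1
    have hinv : Inv c σ α (DialARide.advance σ s e) := by
      refine h.advance hc hα hte (fun e' he' => ?_) fun hidle => ?_
      · rw [h1] at he'
        exact (Option.some.inj he').le
      · simp [dueTime, hidle] at h1
    refine hinv.finishPart hc (by linarith) ?_
    have h4 := advance_dueTime_pos h1 hte
    rw [h4]
    have hcmd' : (DialARide.advance σ s e).cmd = s.cmd := rfl
    unfold waypoint at h4 ⊢
    rw [hcmd']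
    split <;> simp_all
  · rwa [h3]

/-- The schedules that are started by the algorithm are good. If the server has waited, this holds
because no offline solution beats the schedule; else because the last schedule was good. -/
lemma Inv.goodSchedule (hc : 1 ≤ c) (tb : TieBreak c) {α : ℝ} (hα : α ^ 2 = α + 1 / 2)
    (hα1 : 4 / 3 ≤ α) (hα2 : α ≤ 2) {s : State n} (h : Inv c σ α s) (hcmd : s.cmd = .idle)
    (htime : α * optAt c σ s.time ≤ s.time) (hne : (pending σ s).Nonempty) :
    GoodSchedule c σ α s.time s.pos (pending σ s)
      (tb.schedule σ s.time (pending σ s) s.pos) := by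
  obtain ⟨hpos, h⟩ := h
  rw [hcmd] at h
  obtain ⟨-, h2, h3⟩ := h
  have hS := tb.schedule_spec σ s.time (pending σ s) s.pos
  have hsub : pending σ s ⊆ released σ s.time := Finset.sdiff_subset
  have hLB := fun F (hF : Feasible c σ (pending σ s) F) =>
    travel_add_le_of_feasible hα2 hpos hne
      (fun i hi => h2 i (Finset.mem_sdiff.1 hi).2) hS hF
  refine ⟨hpos, hne, hsub, hS.1, htime, hLB, ?_⟩
  rcases h3 with h3 | ⟨t, x, R, S, hg, ht, hp, hrel⟩
  · have h4 : travel σ s.pos (tb.schedule σ s.time (pending σ s) s.pos) ≤ optAt c σ s.time :=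
      le_opt hc fun F hF => by
        have := hLB F (hF.subset hsub)
        nlinarith
    linarith
  · have hts : t ≤ s.time := by linarith [travel_nonneg (σ := σ) S x]
    rw [hp] at hS ⊢
    have := hg.next hc hα hα1 hne (V := released σ s.time) (fun i hi => ?_) hsub
      (released_mono hts) hS
    · rwa [← ht] at this
    · by_contra! hi'
      exact (Finset.mem_sdiff.1 hi).2 (hrel (mem_released.2 hi'))

lemma Inv.step (hc : 1 ≤ c) (tb : TieBreak c) {α : ℝ} (hα : α ^ 2 = α + 1 / 2)
    (hα1 : 4 / 3 ≤ α) (hα2 : α ≤ 2) {s : State n} (h : Inv c σ α s) :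
    Inv c σ α (step tb α σ s) := by
  unfold DialARide.step
  split
  · rename_i hcmd
    split_ifs with h1 h2
    · have h' := h.2
      rw [hcmd] at h'
      exact ⟨h.1, h'.1, h'.2.1, h1.le, le_rfl⟩
    · push Not at h1
      have hg := h.goodSchedule hc tb hα hα1 hα2 hcmd h1 h2
      have h' := h.2
      rw [hcmd] at h'
      refine ⟨h.1, s.time, s.pos, pending σ s, _, pending σ s, hg, le_rfl, rfl, rfl, ?_,
        fun i hi => ?_⟩
      · change Serves c _ s.loaded _
        rw [h'.1]
        exact hg.serves
      · by_cases his : i ∈ s.served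
        · exact .inl his
        · exact .inr (.inr (Finset.mem_sdiff.2 ⟨hi, his⟩))
    · exact h.elapse hc tb (by linarith)
  · exact h.elapse hc tb (by linarith)

lemma Inv.lazyRun (hc : 1 ≤ c) (tb : TieBreak c) {α : ℝ} (hα : α ^ 2 = α + 1 / 2)
    (hα1 : 4 / 3 ≤ α) (hα2 : α ≤ 2) (k : ℕ) : Inv c σ α (lazyRun tb α σ k) := by
  induction k with
  | zero => exact Inv.start hc (by linarith)
  | succ k ih =>
    have : DialARide.lazyRun tb α σ (k + 1) = DialARide.step tb α σ (DialARide.lazyRun tb α σ k) :=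
      Function.iterate_succ_apply' _ _ _
    rw [this]
    exact ih.step hc tb hα hα1 hα2

/-! ### Termination -/

/-- The requests that are unloaded in `L`. -/
def unloaded (L : List (Action n)) : Finset (Fin n) :=
  (L.filterMap fun
    | .load _ => none
    | .unload i => some i).toFinset

lemma mem_unloaded {L : List (Action n)} {i : Fin n} : i ∈ unloaded L ↔ .unload i ∈ L := by
  simp only [unloaded, List.mem_toFinset, List.mem_filterMap]
  constructor
  · rintro ⟨_ | j, h1, h2⟩
    · simp at h2
    · rwa [← Option.some.inj h2]
  · exact fun h => ⟨_, h, rfl⟩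

/-- The requests that are served, or will be served by the current schedule. -/
def covered (s : State n) : Finset (Fin n) :=
  match s.cmd with
  | .followSchedule L => s.served ∪ unloaded L
  | _ => s.served

/-- The progress of the current command. If no requests arrive, this decreases in each step until a
schedule is started: an outdated deadline (`3`) makes the server idle (`2`), then wait for the
current deadline (`1`), and then be idle and ready to start (`0`). -/
noncomputable def phase (c : ℕ∞) (σ : Fin n → Request) (α : ℝ) (s : State n) : ℕ :=
  match s.cmd with
  | .idle => if s.time < α * optAt c σ s.time then 2 else 0
  | .waitUntil τ => if τ < α * optAt c σ s.time then 3 else 1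
  | .followSchedule L => L.length + 3
  | .deliverAndReturn L => L.length + 3

/-- The termination measure. In each step, a request is released; or else a schedule for all known
requests is started; or else the current command makes progress. -/
noncomputable def rank (c : ℕ∞) (σ : Fin n → Request) (α : ℝ) (s : State n) : ℕ × ℕ × ℕ :=
  ((released σ s.time)ᶜ.card, (covered s)ᶜ.card, phase c σ α s)

/-- The order of the termination measure. -/
abbrev RankLT : ℕ × ℕ × ℕ → ℕ × ℕ × ℕ → Prop :=
  Prod.Lex (· < ·) (Prod.Lex (· < ·) (· < ·))

lemma rankLT_of_released {α : ℝ} {s s' : State n} {i : Fin n} (hi : s.time < (σ i).release)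
    (hs' : s'.time = (σ i).release) : RankLT (rank c σ α s') (rank c σ α s) := by
  refine Prod.Lex.left _ _ (Finset.card_lt_card ?_)
  rw [Finset.compl_ssubset_compl, hs']
  exact Finset.ssubset_iff_subset_ne.2 ⟨released_mono hi.le, fun h => not_le.2 hi
    (mem_released.1 (h ▸ mem_released.2 le_rfl))⟩

lemma rankLT_of_phase {α : ℝ} {s s' : State n} (h1 : released σ s'.time = released σ s.time)
    (h2 : covered s ⊆ covered s') (h3 : phase c σ α s' < phase c σ α s) :
    RankLT (rank c σ α s') (rank c σ α s) := by
  unfold rank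
  rw [h1]
  refine Prod.Lex.right _ ?_
  rcases (Finset.card_le_card (Finset.compl_subset_compl.2 h2)).lt_or_eq with h | h
  · exact Prod.Lex.left _ _ h
  · rw [h]
    exact Prod.Lex.right _ h3

lemma covered_subset_finishPart (s : State n) : covered s ⊆ covered (finishPart s) := by
  rcases hcmd : s.cmd with _ | τ | (_ | ⟨_ | i, L⟩) | (_ | ⟨_ | i, L⟩) <;> intro j <;>
    simp only [covered, finishPart, hcmd, perform, Finset.mem_union, mem_unloaded,
      Finset.mem_insert, List.mem_cons, List.not_mem_nil, reduceCtorEq, Action.unload.injEq] <;>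
    tauto

lemma rankLT_step (tb : TieBreak c) {α : ℝ} {s : State n} (h : Inv c σ α s)
    (hs : s.served ≠ Finset.univ) : RankLT (rank c σ α (step tb α σ s)) (rank c σ α s) := by
  have hreceive : ∀ r, (receive tb α σ (advance σ s r)).time = r := fun r => by
    unfold receive
    simp only
    split_ifs <;> rfl
  have helapse : (s.cmd = .idle → ¬ released σ s.time = Finset.univ) →
      RankLT (rank c σ α (elapse tb α σ s)) (rank c σ α s) := by
    intro hidle
    rcases elapse_cases tb α s h.time_le_dueTime with ⟨i, h1, -, h3⟩ | ⟨e, h1, h2, h3⟩ | ⟨h1, h2, -⟩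
    · rw [h3]
      exact rankLT_of_released h1 (hreceive _)
    · have htime : (finishPart (advance σ s e)).time = e := by
        rcases hcmd : s.cmd with _ | τ | (_ | ⟨_ | i, L⟩) | (_ | ⟨_ | i, L⟩) <;>
          simp [advance, finishPart, hcmd, perform]
      have hopt : optAt c σ e = optAt c σ s.time := by unfold optAt; rw [h2]
      rw [h3]
      refine rankLT_of_phase (by rw [htime, h2]) ?_ ?_
      · have h4 := covered_subset_finishPart (advance σ s e)
        exact h4
      · unfold phase
        rw [htime, hopt]
        rcases hcmd : s.cmd with _ | τ | (_ | ⟨a, L⟩) | (_ | ⟨a, L⟩)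
        · simp [dueTime, hcmd] at h1
        · have h5 : τ = e := by simpa [dueTime, hcmd] using h1
          simp only [advance, finishPart, hcmd, h5]
          split_ifs <;> omega
        all_goals
          simp only [advance, finishPart, hcmd, List.length_cons, List.length_nil]
          try split_ifs
          all_goals omega
    · refine absurd h2 (hidle ?_)
      unfold dueTime at h1
      split at h1 <;> simp_all
  unfold step
  split
  · rename_i hcmd
    split_ifs with h1 h2
    · refine rankLT_of_phase rfl ?_ ?_
      · simp [covered, hcmd]
      · simp [phase, hcmd, h1]
    · refine Prod.Lex.right _ (Prod.Lex.left _ _ (Finset.card_lt_card ?_))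
      rw [Finset.compl_ssubset_compl]
      obtain ⟨j, hj⟩ := h2
      refine Finset.ssubset_iff_subset_ne.2 ⟨?_, fun heq => (Finset.mem_sdiff.1 hj).2 ?_⟩
      · simp only [covered, hcmd]
        exact Finset.subset_union_left
      · have h3 : covered s = s.served := by simp [covered, hcmd]
        rw [← h3, heq]
        refine Finset.mem_union_right _ (mem_unloaded.2 ?_)
        exact (tb.schedule_spec σ s.time (pending σ s) s.pos).1.unload_mem j (.inl hj)
    · refine helapse fun _ hrel => hs (Finset.univ_subset_iff.1 ?_)
      rw [Finset.not_nonempty_iff_eq_empty, pending, hrel, Finset.sdiff_eq_empty_iff_subset] at h2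
      exact h2
  · rename_i hcmd
    exact helapse fun h' => absurd h' hcmd

lemma exists_served_eq_univ (hc : 1 ≤ c) (tb : TieBreak c) {α : ℝ} (hα : α ^ 2 = α + 1 / 2)
    (hα1 : 4 / 3 ≤ α) (hα2 : α ≤ 2) : ∃ k, (lazyRun tb α σ k).served = Finset.univ := by
  have hwf : WellFounded (InvImage RankLT (rank c σ α)) :=
    InvImage.wf _ (WellFounded.prod_lex wellFounded_lt (WellFounded.prod_lex wellFounded_lt
      wellFounded_lt))
  have key : ∀ s, Inv c σ α s → ∃ k, ((step tb α σ)^[k] s).served = Finset.univ := by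
    intro s
    induction s using hwf.induction with
    | _ s ih =>
      intro hs
      by_cases h : s.served = Finset.univ
      · exact ⟨0, h⟩
      · obtain ⟨k, hk⟩ := ih _ (rankLT_step tb hs h) (hs.step hc tb hα hα1 hα2)
        exact ⟨k + 1, hk⟩
  exact key _ (Inv.start hc (by linarith))

lemma isCompetitive (hc : 1 ≤ c) (tb : TieBreak c) {α : ℝ} (hα : α ^ 2 = α + 1 / 2)
    (hα1 : 4 / 3 ≤ α) (hα2 : α ≤ 2) : IsCompetitive c (LazyCompletesAt tb α) (α + 1) := by
  classical
  intro n σ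
  have h := exists_served_eq_univ (σ := σ) hc tb hα hα1 hα2
  exact ⟨_, ⟨Nat.find h, Nat.find_spec h, rfl, fun j hj => Nat.find_min h hj⟩,
    add_comm 1 α ▸ (Inv.lazyRun hc tb hα hα1 hα2 _).time_le hc (by linarith)⟩

/-! ### The lower bound -/

/-- A single request at position `1`, released at time `0`. -/
def singleRequest : Fin 1 → Request := fun _ => ⟨1, 1, 0⟩

lemma Serves.eq_of_fin_one {c : ℕ∞} {L : List (Action 1)} (h : Serves c Finset.univ ∅ L) :
    L = [.load 0, .unload 0] := by
  have hlen := Serves.length_eq L _ _ (Finset.disjoint_empty_right _) h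
  have herase : (Finset.univ : Finset (Fin 1)).erase 0 = ∅ := by decide
  rcases L with _ | ⟨a, _ | ⟨b, _ | ⟨d, L⟩⟩⟩
  · simp at hlen
  · simp at hlen
  · rcases a with i | i
    · obtain rfl := Subsingleton.elim i 0
      rcases b with j | j
      · obtain rfl := Subsingleton.elim j 0
        exact absurd h.2.2.1 (Finset.notMem_erase _ _)
      · obtain rfl := Subsingleton.elim j 0
        rfl
    · exact absurd h.1 (Finset.notMem_empty i)
  · simp at hlen

lemma opt_singleRequest {c : ℕ∞} (hc : 1 ≤ c) : opt c singleRequest Finset.univ = 1 := by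
  refine le_antisymm (opt_le ⟨[.load 0, .unload 0], ?_, ?_⟩) (le_opt hc ?_)
  · simpa [Serves] using hc
  · refine ⟨1, ?_, ?_, 1, ?_, ?_, le_rfl⟩ <;> simp [Action.place, Action.earliest, singleRequest]
  · rintro T ⟨L, h1, h2⟩
    rw [h1.eq_of_fin_one] at h2
    have := h2.add_travel_le
    simpa [travel, Action.place, singleRequest] using this

lemma released_singleRequest {t : ℝ} (ht : 0 ≤ t) : released singleRequest t = Finset.univ := by
  refine Finset.eq_univ_of_forall fun i => mem_released.2 ?_
  simpa [singleRequest] using ht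

lemma nextRelease_singleRequest {t : ℝ} (ht : 0 ≤ t) : nextRelease singleRequest t = none := by
  unfold nextRelease
  simp [singleRequest, not_lt.2 ht]

/-- On the single request at `1`, the server idles in the origin until time `α`. -/
lemma lazyCompletesAt_singleRequest {c : ℕ∞} (hc : 1 ≤ c) (tb : TieBreak c) {α : ℝ} (hα : 0 < α)
    {T : ℝ} (hT : LazyCompletesAt tb α 1 singleRequest T) : T = α + 1 := by
  have hopt : ∀ t, 0 ≤ t → optAt c singleRequest t = 1 := fun t ht => by
    rw [optAt, released_singleRequest ht, opt_singleRequest hc]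
  have hsucc : ∀ k, lazyRun tb α singleRequest (k + 1) =
      step tb α singleRequest (lazyRun tb α singleRequest k) := fun k =>
    Function.iterate_succ_apply' _ _ _
  have h0 : lazyRun tb α singleRequest 0 = ⟨0, 0, ∅, ∅, .idle⟩ := rfl
  have h1 : lazyRun tb α singleRequest 1 = ⟨0, 0, ∅, ∅, .waitUntil α⟩ := by
    rw [hsucc, h0]
    simp [step, hopt, hα]
  have h2 : lazyRun tb α singleRequest 2 = ⟨α, 0, ∅, ∅, .idle⟩ := by
    rw [hsucc, h1]
    simp [step, elapse, nextRelease_singleRequest, dueTime, finishPart, advance, waypoint,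
      moveTowards_self, hα.le]
  have h3 : lazyRun tb α singleRequest 3 =
      ⟨α, 0, ∅, ∅, .followSchedule [.load 0, .unload 0]⟩ := by
    have hp : pending singleRequest ⟨α, 0, ∅, ∅, .idle⟩ = Finset.univ := by
      simp [pending, released_singleRequest hα.le]
    rw [hsucc, h2]
    simp only [step, hopt α hα.le, hp, mul_one, lt_irrefl, if_false, Finset.univ_nonempty, if_true,
      (tb.schedule_spec singleRequest α Finset.univ 0).1.eq_of_fin_one]
  have h4 : lazyRun tb α singleRequest 4 = ⟨α + 1, 1, {0}, ∅, .followSchedule [.unload 0]⟩ := by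
    rw [hsucc, h3]
    simp [step, elapse, nextRelease_singleRequest, dueTime, finishPart, advance, waypoint,
      moveTowards, perform, Action.place, singleRequest, hα.le]
  have h5 : lazyRun tb α singleRequest 5 = ⟨α + 1, 1, ∅, {0}, .followSchedule []⟩ := by
    have : 0 ≤ α + 1 := by linarith
    rw [hsucc, h4]
    simp [step, elapse, nextRelease_singleRequest, dueTime, finishPart, advance, waypoint,
      moveTowards, perform, Action.place, singleRequest, this]
  have hearly : ∀ k < 5, (lazyRun tb α singleRequest k).served = ∅ := fun k hk => by
    interval_cases k
    exacts [by rw [h0], by rw [h1], by rw [h2], by rw [h3], by rw [h4]]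
  obtain ⟨k, hk, rfl, hmin⟩ := hT
  have hk5 : k = 5 := by
    refine le_antisymm (not_lt.1 fun hlt => hmin 5 hlt ?_) (not_lt.1 fun hlt => ?_)
    · rw [h5, Finset.univ_unique]
      rfl
    · rw [hearly k hlt] at hk
      exact Finset.univ_nonempty.ne_empty hk.symm
  rw [hk5, h5]

end DialARide

theorem theorem2 (c : ℕ∞) (hc : 1 ≤ c) (tb : DialARide.TieBreak c) :
    DialARide.competitiveRatio c (DialARide.LazyCompletesAt tb ((1 + √3) / 2)) =
      (1 + √3) / 2 + 1 := by
  have hsq : √3 ^ 2 = 3 := Real.sq_sqrt (by norm_num)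
  have h1 : 5 / 3 ≤ √3 := Real.le_sqrt_of_sq_le (by norm_num)
  have h2 : √3 ≤ 3 := Real.sqrt_le_iff.2 (by norm_num)
  have hcomp := DialARide.isCompetitive hc tb (α := (1 + √3) / 2)
    (by linear_combination hsq / 4) (by linarith) (by linarith)
  refine IsLeast.csInf_eq ⟨⟨by linarith, hcomp⟩, fun ρ hρ => ?_⟩
  obtain ⟨T, hT, hle⟩ := hρ.2 1 DialARide.singleRequest
  rwa [DialARide.lazyCompletesAt_singleRequest hc tb (by linarith) hT,
    DialARide.opt_singleRequest hc, mul_one] at hle
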